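/- **Setting.** Let $l,n,m,p$ be nonnegative integers, $\Lambda=\{1,\dots,l\}$, $K=\{1,\dots,m\}$, $J=\{1,\dots,p\}$; $\mathbb{R}^n$ carries the Euclidean norm, $\mathbb{B}^n$ is its closed unit ball, and $\mathcal{I}$ is the set of closed bounded real intervals $Q=[\underline q,\overline q]$, with center $q^c=\frac{\underline q+\overline q}{2}$, width $q^w=\frac{\overline q-\underline q}{2}$ and $[\underline q,\overline q]+[\underline r,\overline r]=[\underline q+\underline r,\overline q+\overline r]$. Write $Q\prec_{CW}R$ if $q^c<r^c$ and $q^w<r^w$. An interval-valued function $f=[\underline f,\overline f]:\mathbb{R}^n\to\mathcal{I}$ is locally Lipschitz if every $u_0\in\mathbb{R}^n$ has a neighbourhood $U$ and an $L>0$ with $\|f(u_1)\ominus_{gH}f(u_2)\|_{\mathcal I}=\max\{|\underline f(u_1)-\underline f(u_2)|,|\overline f(u_1)-\overline f(u_2)|\}\le L\|u_1-u_2\|$ for all $u_1,u_2\in U$. For a locally Lipschitz $\psi:\mathbb{R}^n\to\mathbb{R}$, let $\psi^0(z;w)=\limsup_{u\to z,\,t\to0^+}\frac{\psi(u+tw)-\psi(u)}{t}$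 and let $\partial^0\psi(z)=\{z^*\in\mathbb{R}^n:\langle z^*,w\rangle\le\psi^0(z;w)\ \forall w\in\mathbb{R}^n\}$ be the Clarke generalized gradient. For a locally Lipschitz $f:\mathbb{R}^n\to\mathcal{I}$, let $\partial^0f(u)=\mathrm{co}\,(\partial^0f^c(u)\cup\partial^0f^w(u))$. **Game.** Each player $i\in\Lambda$ has constraint functions $g^i_j:\mathbb{R}^n\to\mathbb{R}$ ($j\in J$), the strategy set $S^i=\{u\in\mathbb{R}^n:g^i_j(u)\le0\ \forall j\in J\}$, and interval-valued losses $F^i_k:(\mathbb{R}^n)^l\to\mathcal{I}$ ($k\in K$). Write $(y,\overline u_{-i})$ for the profile obtained from $\overline u$ by replacing its $i$-th entry by $y$. For $\varepsilon\in\mathbb{R}^m_+$, a profile $\overline u\in\prod_{i\in\Lambda}S^i$ is a weak $\varepsilon$-Nash equilibrium if for no $i\in\Lambda$ there is $y\in S^i$ with $F^i_k(y,\overline u_{-i})+[0,\varepsilon_k]\prec_{CW}F^i_k(\overline u)$ for all $k\in K$. Put $I^i(x)=\{j\in J:g^i_j(x)=0\}$ and $\overline B^i(\overline u_i,\delta)=\{x\in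 S^i:\|x-\overline u_i\|\le\delta\}$. The basic constraint qualification (BCQ) for player $i$ holds at $x\in S^i$ if there is no $\mu\in\mathbb{R}^p_+\setminus\{0\}$ with $\mu_j=0$ for all $j\notin I^i(x)$ and $0\in\sum_{j\in J}\mu_j\partial^0g^i_j(x)$. **Theorem 5.1.** Let $\varepsilon\in\mathbb{R}^m_+\setminus\{0\}$ and let $\overline u$ be a weak $\varepsilon$-Nash equilibrium. Assume that for all $i\in\Lambda$, $k\in K$, $j\in J$ the functions $F^i_k(\cdot,\overline u_{-i})$ and $g^i_j$ are locally Lipschitz on $\mathbb{R}^n$. Let $\delta>0$ and assume that for every $i\in\Lambda$ the BCQ for player $i$ holds at every point of $\overline B^i(\overline u_i,\delta)$. Then for every $i\in\Lambda$ there exist $x^i_\delta\in\overline B^i(\overline u_i,\delta)$, $\lambda^i\in\mathbb{R}^m_+$ with $\sum_{k\in K}\lambda^i_k=1$, and $\mu^i\in\mathbb{R}^p_+$ such that $$0\in\sum_{k\in K}\lambda^i_k\,\partial^0\big(F^i_k(\cdot,\overline u_{-i})\big)(x^i_\delta)+\sum_{j\in I^i(x^i_\delta)}\mu^i_j\,\partial^0g^i_j(x^i_\delta)+\frac1\delta\max_{k\in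 K}\{\varepsilon_k\}\,\mathbb{B}^n,$$ $$\mu^i_j\,g^i_j(x^i_\delta)=0\quad\text{for all }j\in J.$$ -/

import Mathlib

open Filter Topology
open scoped NNReal Pointwise

noncomputable section

/-! ### Closed bounded real intervals

The set of all closed bounded intervals `[q, q']` with `q ≤ q'` is Mathlib's `NonemptyInterval ℝ`,
whose addition and subtraction are the usual interval operations
`[a, b] + [c, d] = [a + c, b + d]` and `[a, b] - [c, d] = [a - d, b - c]`. -/

namespace RealInterval

/-- The center of an interval. -/
def center (Q : NonemptyInterval ℝ) : ℝ := (Q.fst + Q.snd) / 2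

/-- The (half-)width of an interval. -/
def width (Q : NonemptyInterval ℝ) : ℝ := (Q.snd - Q.fst) / 2

/-- The norm `max {|q|, |q'|}` of the interval `[q, q']`. -/
def norm (Q : NonemptyInterval ℝ) : ℝ := max |Q.fst| |Q.snd|

/-- The generalized Hukuhara difference of two intervals. -/
def gHSub (Q R : NonemptyInterval ℝ) : NonemptyInterval ℝ :=
  ⟨(min (Q.fst - R.fst) (Q.snd - R.snd), max (Q.fst - R.fst) (Q.snd - R.snd)), min_le_max⟩

/-- The defining property of the generalized Hukuhara difference. -/
theorem gHSub_eq_iff (Q R P : NonemptyInterval ℝ) :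
    gHSub Q R = P ↔ Q = R + P ∨ R = Q - P := by
  obtain ⟨⟨a, b⟩, hab⟩ := Q
  obtain ⟨⟨c, d⟩, hcd⟩ := R
  obtain ⟨⟨e, f⟩, hef⟩ := P
  simp only [gHSub, NonemptyInterval.ext_iff, Prod.ext_iff, NonemptyInterval.fst_add,
    NonemptyInterval.snd_add, NonemptyInterval.fst_sub, NonemptyInterval.snd_sub] at *
  constructor
  · rintro ⟨h1, h2⟩
    rcases le_total (a - c) (b - d) with h | h
    · rw [min_eq_left h] at h1
      rw [max_eq_right h] at h2
      left; constructor <;> linarith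
    · rw [min_eq_right h] at h1
      rw [max_eq_left h] at h2
      right; constructor <;> linarith
  · rintro (⟨h1, h2⟩ | ⟨h1, h2⟩)
    · rw [min_eq_left (by linarith), max_eq_right (by linarith)]
      constructor <;> linarith
    · rw [min_eq_right (by linarith), max_eq_left (by linarith)]
      constructor <;> linarith

/-- The strict center-width order on intervals. -/
def CWLT (Q R : NonemptyInterval ℝ) : Prop := center Q < center R ∧ width Q < width R

/-- The interval `[0, t]` for `t ≥ 0`. -/
def zeroTo (t : ℝ≥0) : NonemptyInterval ℝ := ⟨(0, (t : ℝ)), t.2⟩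

end RealInterval

/-! ### Clarke's generalized gradient on `ℝⁿ` -/

/-- Clarke's generalized directional derivative of `ψ` at `z` in the direction `w`.
For a locally Lipschitz `ψ` the quotients are bounded near `(z, 0)`, so that the real-valued
`limsup` is the genuine one. -/
def clarkeDeriv {n : ℕ} (ψ : EuclideanSpace ℝ (Fin n) → ℝ) (z w : EuclideanSpace ℝ (Fin n)) : ℝ :=
  limsup (fun q : EuclideanSpace ℝ (Fin n) × ℝ => (ψ (q.1 + q.2 • w) - ψ q.1) / q.2)
    (𝓝 z ×ˢ 𝓝[>] (0 : ℝ))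

/-- Clarke's generalized gradient of `ψ` at `z`. -/
def clarkeGradient {n : ℕ} (ψ : EuclideanSpace ℝ (Fin n) → ℝ) (z : EuclideanSpace ℝ (Fin n)) :
    Set (EuclideanSpace ℝ (Fin n)) :=
  {ζ | ∀ w, inner ℝ ζ w ≤ clarkeDeriv ψ z w}

/-! ### Interval-valued functions -/

namespace IntervalFun

/-- Local Lipschitz continuity of an interval-valued function on `ℝⁿ`. -/
def LocallyLipschitz {n : ℕ} (f : EuclideanSpace ℝ (Fin n) → NonemptyInterval ℝ) : Prop :=
  ∀ u₀, ∃ U ∈ 𝓝 u₀, ∃ L : ℝ, 0 < L ∧ ∀ u₁ ∈ U, ∀ u₂ ∈ U,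
    RealInterval.norm (RealInterval.gHSub (f u₁) (f u₂)) ≤ L * ‖u₁ - u₂‖

/-- The weakly generalized gradient of an interval-valued function: the convex hull of the
Clarke gradients of its center and of its width. -/
def weakGradient {n : ℕ} (f : EuclideanSpace ℝ (Fin n) → NonemptyInterval ℝ)
    (u : EuclideanSpace ℝ (Fin n)) : Set (EuclideanSpace ℝ (Fin n)) :=
  convexHull ℝ (clarkeGradient (fun v => RealInterval.center (f v)) u ∪
    clarkeGradient (fun v => RealInterval.width (f v)) u)

end IntervalFun

/-! ### Constraints -/

open Classical in
/-- The indices of the constraints `g j ≤ 0` that are active at `u`. -/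
def activeSet {n p : ℕ} (g : Fin p → EuclideanSpace ℝ (Fin n) → ℝ)
    (u : EuclideanSpace ℝ (Fin n)) : Finset (Fin p) :=
  Finset.univ.filter fun j => g j u = 0

/-- The basic constraint qualification at `u`. -/
def BCQ {n p : ℕ} (g : Fin p → EuclideanSpace ℝ (Fin n) → ℝ)
    (u : EuclideanSpace ℝ (Fin n)) : Prop :=
  ¬ ∃ μ : Fin p → ℝ, 0 ≤ μ ∧ μ ≠ 0 ∧ (∀ j, j ∉ activeSet g u → μ j = 0) ∧
    (0 : EuclideanSpace ℝ (Fin n)) ∈ ∑ j, μ j • clarkeGradient (g j) u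

/-! ### The game -/

/-- The data of a noncooperative game with `l` players, strategies in `ℝⁿ`, `p` constraints for
each player, and `m` interval-valued losses for each player. Losses are functions of the whole
profile `(u_1, …, u_l)` of points of `ℝⁿ`. -/
structure IntervalGame (l n m p : ℕ) where
  /-- the constraint functions `g^i_j` -/
  constr : Fin l → Fin p → EuclideanSpace ℝ (Fin n) → ℝ
  /-- the losses `F^i_k` -/
  loss : Fin l → Fin m → (Fin l → EuclideanSpace ℝ (Fin n)) → NonemptyInterval ℝ

namespace IntervalGame

variable {l n m p : ℕ}

/-- The strategy set `S^i` of player `i`. -/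
def strategySet (G : IntervalGame l n m p) (i : Fin l) : Set (EuclideanSpace ℝ (Fin n)) :=
  {u | ∀ j, G.constr i j u ≤ 0}

/-- The strategy space, the product of the strategy sets. -/
def strategySpace (G : IntervalGame l n m p) : Set (Fin l → EuclideanSpace ℝ (Fin n)) :=
  {u | ∀ i, u i ∈ G.strategySet i}

/-- The points of `S^i` at distance at most `δ` from `c`. -/
def strategyBall (G : IntervalGame l n m p) (i : Fin l) (c : EuclideanSpace ℝ (Fin n)) (δ : ℝ) :
    Set (EuclideanSpace ℝ (Fin n)) :=
  {x | x ∈ G.strategySet i ∧ ‖x - c‖ ≤ δ}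

/-- The loss `F^i_k(·, u_{-i})` of player `i` as a function of the own strategy only, the
strategies of the others being those of the profile `u`. -/
def ownLoss (G : IntervalGame l n m p) (i : Fin l) (k : Fin m)
    (u : Fin l → EuclideanSpace ℝ (Fin n)) (x : EuclideanSpace ℝ (Fin n)) : NonemptyInterval ℝ :=
  G.loss i k (Function.update u i x)

/-- Weak `ε`-Nash equilibria. -/
def IsWeakNash (G : IntervalGame l n m p) (ε : Fin m → ℝ≥0)
    (u : Fin l → EuclideanSpace ℝ (Fin n)) : Prop :=
  u ∈ G.strategySpace ∧ ∀ i, ¬ ∃ y ∈ G.strategySet i,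
    ∀ k, RealInterval.CWLT (G.ownLoss i k u y + RealInterval.zeroTo (ε k)) (G.loss i k u)

end IntervalGame

end

/-! Fix a player. Adding `[0, ε k]` to an interval raises its center and its width by `ε k / 2`
each. So the equilibrium property says that `φ`, the maximum over `k` of the shifted center and
width differences, is nonnegative on the strategy set, and `φ ≤ e / 2` at the equilibrium strategy,
where `e` is the largest `ε k`. In finite dimension compactness replaces Ekeland's principle: the
penalized function `φ + (e / 2 / δ) * ‖· - u i‖` has a constrained local minimizer `x` within `δ` of
`u i` (`exists_isLocalMinOn_add_mul_norm`).

At `x`, no sum or maximum rule for Clarke gradients is needed. The Clarke derivative is the support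
function of the gradient (Hahn–Banach). If `0` were not a convex combination of points of the
ball-enlarged objective gradients and the active constraint gradients, a separating direction would
strictly decrease every penalized center and width while staying feasible, contradicting minimality
(`exists_fritzJohn_multipliers`). The constraint qualification makes the total objective weight
positive, so one can normalize by it (`exists_kkt_multipliers`). -/

/-! ### Clarke derivatives and gradients of locally Lipschitz functions -/

section Clarke

variable {n : ℕ} {ψ : EuclideanSpace ℝ (Fin n) → ℝ}

/-- The difference quotients defining Clarke's directional derivative are bounded near the base
point, uniformly in unit directions. -/
theorem exists_eventually_abs_quotient_le (hψ : LocallyLipschitz ψ)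
    (z : EuclideanSpace ℝ (Fin n)) :
    ∃ L : ℝ, 0 ≤ L ∧ ∀ w, ∀ᶠ q : EuclideanSpace ℝ (Fin n) × ℝ in 𝓝 z ×ˢ 𝓝[>] (0 : ℝ),
      |(ψ (q.1 + q.2 • w) - ψ q.1) / q.2| ≤ L * ‖w‖ := by
  obtain ⟨K, t, ht, hK⟩ := hψ z
  refine ⟨K, K.2, fun w => ?_⟩
  have h1 : Tendsto (fun q : EuclideanSpace ℝ (Fin n) × ℝ => q.1)
      (𝓝 z ×ˢ 𝓝[>] (0 : ℝ)) (𝓝 z) := tendsto_fst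
  have h2 : Tendsto (fun q : EuclideanSpace ℝ (Fin n) × ℝ => q.2)
      (𝓝 z ×ˢ 𝓝[>] (0 : ℝ)) (𝓝[>] 0) := tendsto_snd
  have h3 : Tendsto (fun q : EuclideanSpace ℝ (Fin n) × ℝ => q.1 + q.2 • w)
      (𝓝 z ×ˢ 𝓝[>] (0 : ℝ)) (𝓝 z) := by
    simpa using h1.add ((h2.mono_right nhdsWithin_le_nhds).smul_const w)
  filter_upwards [h1.eventually ht, h3.eventually ht, h2.eventually self_mem_nhdsWithin]
    with q hq1 hq2 hq3
  have hq : 0 < q.2 := hq3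
  have h := hK.dist_le_mul _ hq2 _ hq1
  rw [Real.dist_eq, dist_eq_norm, add_sub_cancel_left, norm_smul, Real.norm_of_nonneg hq.le] at h
  rw [abs_div, abs_of_pos hq, div_le_iff₀ hq]
  linarith

theorem isBoundedUnder_le_quotient (hψ : LocallyLipschitz ψ) (z w : EuclideanSpace ℝ (Fin n)) :
    IsBoundedUnder (· ≤ ·) (𝓝 z ×ˢ 𝓝[>] (0 : ℝ))
      fun q : EuclideanSpace ℝ (Fin n) × ℝ => (ψ (q.1 + q.2 • w) - ψ q.1) / q.2 := by
  obtain ⟨L, -, hL⟩ := exists_eventually_abs_quotient_le hψ z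
  exact ⟨L * ‖w‖, eventually_map.2 ((hL w).mono fun q hq => (abs_le.1 hq).2)⟩

theorem isCoboundedUnder_le_quotient (hψ : LocallyLipschitz ψ)
    (z w : EuclideanSpace ℝ (Fin n)) :
    IsCoboundedUnder (· ≤ ·) (𝓝 z ×ˢ 𝓝[>] (0 : ℝ))
      fun q : EuclideanSpace ℝ (Fin n) × ℝ => (ψ (q.1 + q.2 • w) - ψ q.1) / q.2 := by
  obtain ⟨L, -, hL⟩ := exists_eventually_abs_quotient_le hψ z
  have : IsBoundedUnder (· ≥ ·) (𝓝 z ×ˢ 𝓝[>] (0 : ℝ))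
      fun q : EuclideanSpace ℝ (Fin n) × ℝ => (ψ (q.1 + q.2 • w) - ψ q.1) / q.2 :=
    ⟨-(L * ‖w‖), eventually_map.2 ((hL w).mono fun q hq => (abs_le.1 hq).1)⟩
  exact this.isCoboundedUnder_le

theorem eventually_quotient_lt (hψ : LocallyLipschitz ψ) {z w : EuclideanSpace ℝ (Fin n)} {c : ℝ}
    (hc : clarkeDeriv ψ z w < c) :
    ∀ᶠ q : EuclideanSpace ℝ (Fin n) × ℝ in 𝓝 z ×ˢ 𝓝[>] (0 : ℝ),
      (ψ (q.1 + q.2 • w) - ψ q.1) / q.2 < c :=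
  eventually_lt_of_limsup_lt hc (isBoundedUnder_le_quotient hψ z w)

theorem clarkeDeriv_le (hψ : LocallyLipschitz ψ) {z w : EuclideanSpace ℝ (Fin n)} {c : ℝ}
    (hc : ∀ᶠ q : EuclideanSpace ℝ (Fin n) × ℝ in 𝓝 z ×ˢ 𝓝[>] (0 : ℝ),
      (ψ (q.1 + q.2 • w) - ψ q.1) / q.2 ≤ c) :
    clarkeDeriv ψ z w ≤ c :=
  limsup_le_of_le (isCoboundedUnder_le_quotient hψ z w) hc

theorem exists_clarkeDeriv_le_mul_norm (hψ : LocallyLipschitz ψ)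
    (z : EuclideanSpace ℝ (Fin n)) :
    ∃ L : ℝ, 0 ≤ L ∧ ∀ w, clarkeDeriv ψ z w ≤ L * ‖w‖ := by
  obtain ⟨L, hL0, hL⟩ := exists_eventually_abs_quotient_le hψ z
  exact ⟨L, hL0, fun w => clarkeDeriv_le hψ ((hL w).mono fun q hq => (abs_le.1 hq).2)⟩

/-- The quotient for `v + w` telescopes through `q.1 + q.2 • w`. This moves the base point of the
`v`-quotient, which is harmless because the limsup also runs over base points. -/
theorem clarkeDeriv_add_le (hψ : LocallyLipschitz ψ) (z v w : EuclideanSpace ℝ (Fin n)) :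
    clarkeDeriv ψ z (v + w) ≤ clarkeDeriv ψ z v + clarkeDeriv ψ z w := by
  refine le_of_forall_pos_le_add fun η hη => clarkeDeriv_le hψ ?_
  have hv := eventually_quotient_lt hψ (lt_add_of_pos_right (clarkeDeriv ψ z v) (half_pos hη))
  have hw := eventually_quotient_lt hψ (lt_add_of_pos_right (clarkeDeriv ψ z w) (half_pos hη))
  have h2 : Tendsto (fun q : EuclideanSpace ℝ (Fin n) × ℝ => q.2)
      (𝓝 z ×ˢ 𝓝[>] (0 : ℝ)) (𝓝[>] 0) := tendsto_snd
  have h3 : Tendsto (fun q : EuclideanSpace ℝ (Fin n) × ℝ => (q.1 + q.2 • w, q.2))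
      (𝓝 z ×ˢ 𝓝[>] (0 : ℝ)) (𝓝 z ×ˢ 𝓝[>] (0 : ℝ)) := by
    refine Tendsto.prodMk ?_ h2
    simpa using (tendsto_fst (f := 𝓝 z) (g := 𝓝[>] (0 : ℝ))).add
      ((h2.mono_right nhdsWithin_le_nhds).smul_const w)
  filter_upwards [h3.eventually hv, hw] with q h₁ h₂
  have key : (ψ (q.1 + q.2 • (v + w)) - ψ q.1) / q.2
      = (ψ (q.1 + q.2 • w + q.2 • v) - ψ (q.1 + q.2 • w)) / q.2
        + (ψ (q.1 + q.2 • w) - ψ q.1) / q.2 := by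
    rw [← add_div, smul_add, add_assoc, add_comm (q.2 • w) (q.2 • v)]
    congr 1
    ring
  rw [key]
  linarith

theorem clarkeDeriv_smul_le (hψ : LocallyLipschitz ψ) (z w : EuclideanSpace ℝ (Fin n)) {c : ℝ}
    (hc : 0 < c) : clarkeDeriv ψ z (c • w) ≤ c * clarkeDeriv ψ z w := by
  refine le_of_forall_pos_le_add fun η hη => clarkeDeriv_le hψ ?_
  have hw := eventually_quotient_lt hψ
    (lt_add_of_pos_right (clarkeDeriv ψ z w) (div_pos hη hc))
  have h2 : Tendsto (fun t : ℝ => t * c) (𝓝[>] 0) (𝓝[>] 0) := by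
    refine tendsto_nhdsWithin_of_tendsto_nhds_of_eventually_within _ ?_ ?_
    · exact ((continuous_mul_const c).tendsto' 0 0 (zero_mul c)).mono_left nhdsWithin_le_nhds
    · filter_upwards [self_mem_nhdsWithin] with t ht using mul_pos ht hc
  have h3 : Tendsto (fun q : EuclideanSpace ℝ (Fin n) × ℝ => (q.1, q.2 * c))
      (𝓝 z ×ˢ 𝓝[>] (0 : ℝ)) (𝓝 z ×ˢ 𝓝[>] (0 : ℝ)) :=
    tendsto_fst.prodMk (h2.comp tendsto_snd)
  filter_upwards [h3.eventually hw] with q h₁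
  have key : (ψ (q.1 + q.2 • c • w) - ψ q.1) / q.2
      = c * ((ψ (q.1 + (q.2 * c) • w) - ψ q.1) / (q.2 * c)) := by
    rw [smul_smul]
    field_simp
  have := mul_lt_mul_of_pos_left h₁ hc
  rw [mul_add, mul_div_cancel₀ η hc.ne'] at this
  rw [key]
  exact this.le

theorem clarkeDeriv_smul (hψ : LocallyLipschitz ψ) (z w : EuclideanSpace ℝ (Fin n)) {c : ℝ}
    (hc : 0 < c) : clarkeDeriv ψ z (c • w) = c * clarkeDeriv ψ z w := by
  refine le_antisymm (clarkeDeriv_smul_le hψ z w hc) ?_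
  have h := clarkeDeriv_smul_le hψ z (c • w) (inv_pos.2 hc)
  rw [inv_smul_smul₀ hc.ne', inv_mul_eq_div, le_div_iff₀ hc] at h
  linarith

theorem clarkeDeriv_zero (ψ : EuclideanSpace ℝ (Fin n) → ℝ) (z : EuclideanSpace ℝ (Fin n)) :
    clarkeDeriv ψ z 0 = 0 := by
  simp [clarkeDeriv]

/-- A linear functional on a subspace dominated by the Clarke derivative extends to an element
of the Clarke gradient. -/
theorem exists_mem_clarkeGradient_extension (hψ : LocallyLipschitz ψ)
    (z : EuclideanSpace ℝ (Fin n)) (f : EuclideanSpace ℝ (Fin n) →ₗ.[ℝ] ℝ)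
    (hf : ∀ x : f.domain, f x ≤ clarkeDeriv ψ z x) :
    ∃ ζ ∈ clarkeGradient ψ z, ∀ x : f.domain, inner ℝ ζ (x : EuclideanSpace ℝ (Fin n)) = f x := by
  obtain ⟨g, hg, hgle⟩ := exists_extension_of_le_sublinear f (clarkeDeriv ψ z)
    (fun c hc x => clarkeDeriv_smul hψ z x hc) (clarkeDeriv_add_le hψ z) hf
  -- Riesz representation turns the extended functional into a vector.
  have hinner : ∀ w, inner ℝ ((InnerProductSpace.toDual ℝ (EuclideanSpace ℝ (Fin n))).symm
      (LinearMap.toContinuousLinearMap g)) w = g w := fun w => by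
    rw [InnerProductSpace.toDual_symm_apply]
    rfl
  exact ⟨_, fun w => (hinner w).trans_le (hgle w), fun x => (hinner x).trans (hg x)⟩

/-- The Clarke derivative is the support function of the Clarke gradient. -/
theorem exists_mem_clarkeGradient_inner_eq (hψ : LocallyLipschitz ψ)
    (z w : EuclideanSpace ℝ (Fin n)) :
    ∃ ζ ∈ clarkeGradient ψ z, inner ℝ ζ w = clarkeDeriv ψ z w := by
  rcases eq_or_ne w 0 with rfl | hw
  · obtain ⟨ζ, hζ, -⟩ := exists_mem_clarkeGradient_extension hψ z ⟨⊥, 0⟩ fun x => by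
      obtain ⟨x, hx⟩ := x
      obtain rfl : x = 0 := (Submodule.mem_bot ℝ).1 hx
      simp [clarkeDeriv_zero]
    exact ⟨ζ, hζ, by rw [inner_zero_right, clarkeDeriv_zero]⟩
  · obtain ⟨ζ, hζ, h⟩ := exists_mem_clarkeGradient_extension hψ z
      (LinearPMap.mkSpanSingleton w (clarkeDeriv ψ z w) hw) fun x => by
        obtain ⟨x, hx⟩ := x
        obtain ⟨c, rfl⟩ := Submodule.mem_span_singleton.1 hx
        have e := LinearPMap.mkSpanSingleton'_apply (σ := RingHom.id ℝ) w (clarkeDeriv ψ z w)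
          (fun d hd => (smul_eq_zero.1 hd).elim (fun hd => by simp [hd]) fun h => absurd h hw) c hx
        refine e.trans_le ?_
        rw [RingHom.id_apply, smul_eq_mul]
        dsimp only
        -- Homogeneity covers only positive scalars; for `c < 0` domination follows from
        -- subadditivity on `c • w` and `-c • w`.
        rcases lt_trichotomy c 0 with hc | rfl | hc
        · have h1 := clarkeDeriv_smul hψ z w (neg_pos.2 hc)
          have h2 := clarkeDeriv_add_le hψ z (c • w) (-c • w)
          rw [← add_smul, add_neg_cancel, zero_smul, clarkeDeriv_zero] at h2
          linarith
        · simp [clarkeDeriv_zero]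
        · exact (clarkeDeriv_smul hψ z w hc).ge
    refine ⟨ζ, hζ, ?_⟩
    have := h ⟨w, Submodule.mem_span_singleton_self w⟩
    rw [this]
    exact LinearPMap.mkSpanSingleton_apply ℝ ℝ hw _

theorem clarkeGradient_nonempty (hψ : LocallyLipschitz ψ) (z : EuclideanSpace ℝ (Fin n)) :
    (clarkeGradient ψ z).Nonempty :=
  let ⟨ζ, hζ, _⟩ := exists_mem_clarkeGradient_inner_eq hψ z 0
  ⟨ζ, hζ⟩

theorem convex_clarkeGradient (ψ : EuclideanSpace ℝ (Fin n) → ℝ)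
    (z : EuclideanSpace ℝ (Fin n)) : Convex ℝ (clarkeGradient ψ z) := by
  intro a ha b hb s t hs ht hst w
  rw [inner_add_left, real_inner_smul_left, real_inner_smul_left]
  calc s * inner ℝ a w + t * inner ℝ b w
      ≤ s * clarkeDeriv ψ z w + t * clarkeDeriv ψ z w :=
        add_le_add (mul_le_mul_of_nonneg_left (ha w) hs) (mul_le_mul_of_nonneg_left (hb w) ht)
    _ = clarkeDeriv ψ z w := by rw [← add_mul, hst, one_mul]

/-- Closed as an intersection of half-spaces; bounded because testing `ζ` against itself gives `‖ζ‖
≤ L`. -/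
theorem isCompact_clarkeGradient (hψ : LocallyLipschitz ψ) (z : EuclideanSpace ℝ (Fin n)) :
    IsCompact (clarkeGradient ψ z) := by
  obtain ⟨L, hL0, hL⟩ := exists_clarkeDeriv_le_mul_norm hψ z
  refine (isCompact_closedBall (0 : EuclideanSpace ℝ (Fin n)) L).of_isClosed_subset ?_ ?_
  · rw [clarkeGradient, Set.ofPred_forall]
    exact isClosed_iInter fun w => isClosed_le (by fun_prop) continuous_const
  · intro ζ hζ
    rw [mem_closedBall_zero_iff]
    rcases (norm_nonneg ζ).eq_or_lt with h | h
    · exact h.symm.trans_le hL0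
    · have h1 := (hζ ζ).trans (hL ζ)
      rw [real_inner_self_eq_norm_mul_norm] at h1
      exact le_of_mul_le_mul_right h1 h

/-- A direction with negative Clarke derivative is a descent direction with linear rate. -/
theorem eventually_lt_of_clarkeDeriv_lt (hψ : LocallyLipschitz ψ)
    {z w : EuclideanSpace ℝ (Fin n)} {c : ℝ} (hc : clarkeDeriv ψ z w < c) :
    ∀ᶠ t in 𝓝[>] (0 : ℝ), ψ (z + t • w) < ψ z + t * c := by
  have h : Tendsto (fun t : ℝ => (z, t)) (𝓝[>] 0) (𝓝 z ×ˢ 𝓝[>] (0 : ℝ)) :=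
    tendsto_const_nhds.prodMk tendsto_id
  filter_upwards [h.eventually (eventually_quotient_lt hψ hc), self_mem_nhdsWithin] with t h₁ h₂
  rw [div_lt_iff₀ (show (0 : ℝ) < t from h₂)] at h₁
  linarith

end Clarke

/-! ### Convex hulls and a theorem of the alternative -/

section ConvexAlternative

/-- The hull of two convex sets is the union of the segments joining them, a continuous image of `s
× t × [0, 1]`. -/
theorem IsCompact.convexHull_union {E : Type*} [NormedAddCommGroup E] [NormedSpace ℝ E]
    {s t : Set E} (hs : IsCompact s) (ht : IsCompact t) (hsc : Convex ℝ s) (htc : Convex ℝ t)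
    (hs0 : s.Nonempty) (ht0 : t.Nonempty) : IsCompact (convexHull ℝ (s ∪ t)) := by
  have h : convexHull ℝ (s ∪ t) =
      (fun q : (E × E) × ℝ => AffineMap.lineMap q.1.1 q.1.2 q.2) ''
        ((s ×ˢ t) ×ˢ Set.Icc (0 : ℝ) 1) := by
    rw [hsc.convexHull_union htc hs0 ht0]
    ext x
    simp only [mem_convexJoin, segment_eq_image_lineMap, Set.mem_image, Set.mem_prod, Prod.exists]
    constructor
    · rintro ⟨a, ha, b, hb, r, hr, h⟩
      exact ⟨a, b, r, ⟨⟨ha, hb⟩, hr⟩, h⟩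
    · rintro ⟨a, b, r, ⟨⟨ha, hb⟩, hr⟩, h⟩
      exact ⟨a, ha, b, hb, r, hr, h⟩
  rw [h]
  refine ((hs.prod ht).prod isCompact_Icc).image ?_
  simp only [AffineMap.lineMap_apply_module]
  fun_prop

variable {ι E : Type*} [Fintype ι] [NormedAddCommGroup E] [InnerProductSpace ℝ E]
  [CompleteSpace E]

/-- A theorem of the alternative for a finite family of compact convex sets: either `0` is a convex
combination of points of the sets with indices in `s`, or some direction makes an obtuse angle
with all the points of these sets. -/
theorem exists_convexCombination_eq_zero_or_forall_inner_neg (s : Set ι) {C : ι → Set E}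
    (hC : ∀ a, IsCompact (C a)) (hconv : ∀ a, Convex ℝ (C a)) (hne : ∀ a, (C a).Nonempty) :
    (∃ α ∈ stdSimplex ℝ ι, (∀ a ∉ s, α a = 0) ∧
      ∃ ζ : ι → E, (∀ a, ζ a ∈ C a) ∧ ∑ a, α a • ζ a = 0) ∨
    ∃ w : E, ∀ a ∈ s, ∀ ζ ∈ C a, inner ℝ ζ w < 0 := by
  classical
  set T : Set (ι → ℝ) := stdSimplex ℝ ι ∩ {α | ∀ a ∉ s, α a = 0} with hT
  set D : Set E := (fun q : (ι → ℝ) × (ι → E) => ∑ a, q.1 a • q.2 a) '' (T ×ˢ Set.univ.pi C)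
    with hD
  have hTc : IsCompact T := by
    refine (isCompact_stdSimplex ℝ ι).inter_right ?_
    simp only [Set.ofPred_forall]
    exact isClosed_iInter fun a => isClosed_iInter fun _ =>
      isClosed_eq (continuous_apply a) continuous_const
  have hDc : IsCompact D :=
    (hTc.prod (isCompact_univ_pi hC)).image (by fun_prop)
  have hDconv : Convex ℝ D := by
    rintro _ ⟨⟨α, ζ⟩, ⟨⟨hα, hα0⟩, hζ⟩, rfl⟩ _ ⟨⟨β, ξ⟩, ⟨⟨hβ, hβ0⟩, hξ⟩, rfl⟩ p q hp hq hpq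
    -- Convexity of each `C a` merges the two weighted points into one, also when both weights
    -- vanish.
    have key : ∀ a, ∃ z ∈ C a, (p * α a + q * β a) • z = (p * α a) • ζ a + (q * β a) • ξ a :=
      fun a => (hconv a).exists_mem_add_smul_eq (hζ a trivial) (hξ a trivial)
        (mul_nonneg hp (hα.1 a)) (mul_nonneg hq (hβ.1 a))
    choose z hz hzeq using key
    refine ⟨(p • α + q • β, z), ⟨⟨convex_stdSimplex ℝ ι hα hβ hp hq hpq, fun a ha => ?_⟩,
      fun a _ => hz a⟩, ?_⟩
    · have h1 : α a = 0 := hα0 a ha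
      have h2 : β a = 0 := hβ0 a ha
      simp [h1, h2]
    · simp only [Pi.add_apply, Pi.smul_apply, smul_eq_mul, hzeq, Finset.sum_add_distrib,
        Finset.smul_sum, mul_smul]
  by_cases h0 : (0 : E) ∈ D
  · obtain ⟨⟨α, ζ⟩, ⟨⟨hα, hα0⟩, hζ⟩, h⟩ := h0
    exact Or.inl ⟨α, hα, hα0, ζ, fun a => hζ a trivial, h⟩
  · right
    obtain ⟨f, r, hf, hr⟩ := geometric_hahn_banach_closed_point hDconv hDc.isClosed h0
    rw [map_zero] at hr
    refine ⟨(InnerProductSpace.toDual ℝ E).symm f, fun a ha ζ hζ => ?_⟩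
    rw [real_inner_comm, InnerProductSpace.toDual_symm_apply]
    -- Test the separating functional with all weight on `a`; the other coordinates only need some
    -- point of their sets.
    choose ξ hξ using hne
    refine (hf ζ ⟨(Pi.single a 1, Function.update ξ a ζ), ⟨⟨single_mem_stdSimplex ℝ a, ?_⟩, ?_⟩,
      ?_⟩).trans hr
    · intro b hb
      exact Pi.single_eq_of_ne (fun h : b = a => hb (h ▸ ha)) 1
    · intro b _
      rcases eq_or_ne b a with rfl | hb
      · simpa using hζ
      · simpa [hb] using hξ b
    · simp [Pi.single_apply]

end ConvexAlternative

/-! ### Centers, widths and weak gradients of interval-valued functions -/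

section Interval

variable {n : ℕ} {f : EuclideanSpace ℝ (Fin n) → NonemptyInterval ℝ}

theorem RealInterval.norm_gHSub (Q R : NonemptyInterval ℝ) :
    RealInterval.norm (RealInterval.gHSub Q R) = max |Q.fst - R.fst| |Q.snd - R.snd| := by
  rcases le_total (Q.fst - R.fst) (Q.snd - R.snd) with h | h <;>
    simp [RealInterval.norm, RealInterval.gHSub, h, max_comm]

theorem RealInterval.abs_center_sub_le (Q R : NonemptyInterval ℝ) :
    |center Q - center R| ≤ norm (gHSub Q R) := by
  rw [norm_gHSub, center, center, abs_le]
  have h1 := (le_max_left |Q.fst - R.fst| |Q.snd - R.snd|)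
  have h2 := (le_max_right |Q.fst - R.fst| |Q.snd - R.snd|)
  rw [abs_le] at h1 h2
  constructor <;> linarith [h1.1, h1.2, h2.1, h2.2]

theorem RealInterval.abs_width_sub_le (Q R : NonemptyInterval ℝ) :
    |width Q - width R| ≤ norm (gHSub Q R) := by
  rw [norm_gHSub, width, width, abs_le]
  have h1 := (le_max_left |Q.fst - R.fst| |Q.snd - R.snd|)
  have h2 := (le_max_right |Q.fst - R.fst| |Q.snd - R.snd|)
  rw [abs_le] at h1 h2
  constructor <;> linarith [h1.1, h1.2, h2.1, h2.2]

theorem IntervalFun.LocallyLipschitz.comp_of_abs_sub_le (hf : IntervalFun.LocallyLipschitz f)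
    {φ : NonemptyInterval ℝ → ℝ}
    (hφ : ∀ Q R, |φ Q - φ R| ≤ RealInterval.norm (RealInterval.gHSub Q R)) :
    _root_.LocallyLipschitz fun x => φ (f x) := by
  intro x
  obtain ⟨U, hU, L, hL, h⟩ := hf x
  refine ⟨⟨L, hL.le⟩, U, hU, LipschitzOnWith.of_dist_le_mul fun u hu v hv => ?_⟩
  rw [Real.dist_eq, dist_eq_norm]
  exact (hφ _ _).trans (h u hu v hv)

theorem IntervalFun.LocallyLipschitz.center (hf : IntervalFun.LocallyLipschitz f) :
    _root_.LocallyLipschitz fun x => RealInterval.center (f x) :=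
  hf.comp_of_abs_sub_le RealInterval.abs_center_sub_le

theorem IntervalFun.LocallyLipschitz.width (hf : IntervalFun.LocallyLipschitz f) :
    _root_.LocallyLipschitz fun x => RealInterval.width (f x) :=
  hf.comp_of_abs_sub_le RealInterval.abs_width_sub_le

theorem IntervalFun.weakGradient_nonempty (hf : IntervalFun.LocallyLipschitz f)
    (x : EuclideanSpace ℝ (Fin n)) : (weakGradient f x).Nonempty :=
  ((clarkeGradient_nonempty hf.center x).mono Set.subset_union_left).convexHull

theorem IntervalFun.isCompact_weakGradient (hf : IntervalFun.LocallyLipschitz f)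
    (x : EuclideanSpace ℝ (Fin n)) : IsCompact (weakGradient f x) :=
  (isCompact_clarkeGradient hf.center x).convexHull_union (isCompact_clarkeGradient hf.width x)
    (convex_clarkeGradient _ x) (convex_clarkeGradient _ x)
    (clarkeGradient_nonempty hf.center x) (clarkeGradient_nonempty hf.width x)

end Interval

/-! ### Fritz John and Karush–Kuhn–Tucker multipliers -/

section Multipliers

variable {n m p : ℕ}

/-- A direction obtuse to the Clarke gradient enlarged by a ball of radius `c` is a descent
direction whose rate exceeds `c`. -/
theorem clarkeDeriv_add_mul_norm_neg {ψ : EuclideanSpace ℝ (Fin n) → ℝ} (hψ : LocallyLipschitz ψ)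
    {x w : EuclideanSpace ℝ (Fin n)} {c : ℝ} (hc : 0 ≤ c) {C : Set (EuclideanSpace ℝ (Fin n))}
    (hC : clarkeGradient ψ x ⊆ C) (hw : ∀ ζ ∈ C + Metric.closedBall 0 c, inner ℝ ζ w < 0) :
    clarkeDeriv ψ x w + c * ‖w‖ < 0 := by
  obtain ⟨ζ, hζ, h⟩ := exists_mem_clarkeGradient_inner_eq hψ x w
  -- Pair the maximizing gradient element with the ball point most aligned with `w`; for `w = 0`
  -- that point is `0`.
  have h1 := hw _ (Set.add_mem_add (hC hζ)
    (show (c / ‖w‖) • w ∈ Metric.closedBall (0 : EuclideanSpace ℝ (Fin n)) c from ?_))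
  · rw [inner_add_left, h, real_inner_smul_left, real_inner_self_eq_norm_mul_norm] at h1
    rcases eq_or_ne ‖w‖ 0 with h0 | h0
    · simp_all
    · rwa [← mul_assoc, div_mul_cancel₀ c h0] at h1
  · rw [mem_closedBall_zero_iff, norm_smul, norm_div, norm_norm, Real.norm_of_nonneg hc]
    exact (div_mul_comm _ _ _).trans_le (mul_le_of_le_one_left hc (div_self_le_one _))

/-- **Fritz John conditions** for the maximum of the centers and widths of finitely many
interval-valued functions, perturbed by a multiple of the norm: if no direction is a descent
direction, multipliers exist. -/
theorem exists_fritzJohn_multipliers {f : Fin m → EuclideanSpace ℝ (Fin n) → NonemptyInterval ℝ}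
    (hf : ∀ k, IntervalFun.LocallyLipschitz (f k))
    {g : Fin p → EuclideanSpace ℝ (Fin n) → ℝ} (hg : ∀ j, LocallyLipschitz (g j))
    {x u : EuclideanSpace ℝ (Fin n)} (hx : ∀ j, g j x ≤ 0) {c : ℝ} (hc : 0 ≤ c)
    (hmin : ∀ᶠ y in 𝓝 x, (∀ j, g j y ≤ 0) → ∃ k,
      RealInterval.center (f k x) + c * ‖x - u‖ ≤ RealInterval.center (f k y) + c * ‖y - u‖ ∨
      RealInterval.width (f k x) + c * ‖x - u‖ ≤ RealInterval.width (f k y) + c * ‖y - u‖) :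
    ∃ (α : Fin m → ℝ) (β : Fin p → ℝ) (v b : Fin m → EuclideanSpace ℝ (Fin n))
      (ξ : Fin p → EuclideanSpace ℝ (Fin n)),
      0 ≤ α ∧ 0 ≤ β ∧ ∑ k, α k + ∑ j, β j = 1 ∧ (∀ j ∉ activeSet g x, β j = 0) ∧
      (∀ k, v k ∈ IntervalFun.weakGradient (f k) x) ∧ (∀ k, ‖b k‖ ≤ c) ∧
      (∀ j, ξ j ∈ clarkeGradient (g j) x) ∧
      ∑ k, α k • (v k + b k) + ∑ j, β j • ξ j = 0 := by
  set C : Fin m ⊕ Fin p → Set (EuclideanSpace ℝ (Fin n)) :=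
    Sum.elim (fun k => IntervalFun.weakGradient (f k) x + Metric.closedBall 0 c)
      (fun j => clarkeGradient (g j) x) with hC
  have hCc : ∀ a, IsCompact (C a) := by
    rintro (k | j)
    · exact (IntervalFun.isCompact_weakGradient (hf k) x).add (isCompact_closedBall 0 c)
    · exact isCompact_clarkeGradient (hg j) x
  have hCconv : ∀ a, Convex ℝ (C a) := by
    rintro (k | j)
    · exact (convex_convexHull ℝ _).add (convex_closedBall 0 c)
    · exact convex_clarkeGradient _ x
  have hCne : ∀ a, (C a).Nonempty := by
    rintro (k | j)
    · exact (IntervalFun.weakGradient_nonempty (hf k) x).add (Metric.nonempty_closedBall.2 hc)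
    · exact clarkeGradient_nonempty (hg j) x
  -- The index set keeps all objectives and only the active constraints.
  rcases exists_convexCombination_eq_zero_or_forall_inner_neg
    {a | ∀ j, a = Sum.inr j → j ∈ activeSet g x} hCc hCconv hCne with
    ⟨α, hα, hα0, ζ, hζ, hsum⟩ | ⟨w, hw⟩
  · have hζl : ∀ k, ∃ v ∈ IntervalFun.weakGradient (f k) x,
        ∃ b ∈ Metric.closedBall (0 : EuclideanSpace ℝ (Fin n)) c, v + b = ζ (Sum.inl k) :=
      fun k => Set.mem_add.1 (hζ (Sum.inl k))
    choose v hv b hb hvb using hζl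
    have hα1 := hα.2
    rw [Fintype.sum_sum_type] at hsum hα1
    refine ⟨fun k => α (Sum.inl k), fun j => α (Sum.inr j), v, b, fun j => ζ (Sum.inr j),
      fun k => hα.1 _, fun j => hα.1 _, hα1, fun j hj => hα0 _ fun h => hj (h j rfl), hv,
      fun k => mem_closedBall_zero_iff.1 (hb k), fun j => hζ (Sum.inr j), ?_⟩
    simpa only [hvb] using hsum
  · exfalso
    have hwf : ∀ k, ∀ ζ ∈ IntervalFun.weakGradient (f k) x + Metric.closedBall 0 c,
        inner ℝ ζ w < 0 := fun k => hw (Sum.inl k) fun j hj => by cases hj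
    have hdescent : ∀ {ψ : EuclideanSpace ℝ (Fin n) → ℝ}, LocallyLipschitz ψ →
        clarkeDeriv ψ x w + c * ‖w‖ < 0 →
        ∀ᶠ t in 𝓝[>] (0 : ℝ), ψ (x + t • w) + c * ‖x + t • w - u‖ < ψ x + c * ‖x - u‖ := by
      intro ψ hψ h
      -- The rate `-(c * ‖w‖)` pays for the penalty, which grows by at most `t * (c * ‖w‖)`.
      filter_upwards [eventually_lt_of_clarkeDeriv_lt hψ (c := -(c * ‖w‖)) (by linarith),
        self_mem_nhdsWithin] with t ht ht0
      have h1 : ‖x + t • w - u‖ ≤ ‖x - u‖ + t * ‖w‖ := by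
        rw [add_sub_right_comm]
        refine (norm_add_le _ _).trans_eq ?_
        rw [norm_smul, Real.norm_of_nonneg (le_of_lt ht0)]
      have h2 := mul_le_mul_of_nonneg_left h1 hc
      linarith
    have hcenter : ∀ k, ∀ᶠ t in 𝓝[>] (0 : ℝ),
        RealInterval.center (f k (x + t • w)) + c * ‖x + t • w - u‖
          < RealInterval.center (f k x) + c * ‖x - u‖ := fun k =>
      hdescent (hf k).center (clarkeDeriv_add_mul_norm_neg (hf k).center hc
        (Set.subset_union_left.trans (subset_convexHull ℝ _)) (hwf k))
    have hwidth : ∀ k, ∀ᶠ t in 𝓝[>] (0 : ℝ),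
        RealInterval.width (f k (x + t • w)) + c * ‖x + t • w - u‖
          < RealInterval.width (f k x) + c * ‖x - u‖ := fun k =>
      hdescent (hf k).width (clarkeDeriv_add_mul_norm_neg (hf k).width hc
        (Set.subset_union_right.trans (subset_convexHull ℝ _)) (hwf k))
    have hline : Tendsto (fun t : ℝ => x + t • w) (𝓝[>] 0) (𝓝 x) :=
      (Continuous.tendsto' (by fun_prop) 0 x (by simp)).mono_left nhdsWithin_le_nhds
    have hconstr : ∀ j, ∀ᶠ t in 𝓝[>] (0 : ℝ), g j (x + t • w) ≤ 0 := by
      intro j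
      rcases (hx j).eq_or_lt with h | h
      · obtain ⟨ξ, hξ, hξw⟩ := exists_mem_clarkeGradient_inner_eq (hg j) x w
        have hneg : clarkeDeriv (g j) x w < 0 := by
          rw [← hξw]
          refine hw (Sum.inr j) (fun i hi => ?_) ξ hξ
          obtain rfl : j = i := Sum.inr_injective hi
          simpa [activeSet] using h
        filter_upwards [eventually_lt_of_clarkeDeriv_lt (hg j) hneg] with t ht
        linarith
      · exact (hline.eventually
          ((hg j).continuous.continuousAt.eventually (gt_mem_nhds h))).mono fun t ht => ht.le
    obtain ⟨t, h1, h2, h3, h4⟩ := ((eventually_all.2 hcenter).and ((eventually_all.2 hwidth).and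
      ((eventually_all.2 hconstr).and (hline.eventually hmin)))).exists
    obtain ⟨k, hk | hk⟩ := h4 h3
    · exact (h1 k).not_ge hk
    · exact (h2 k).not_ge hk

/-- Under the basic constraint qualification the Fritz John multipliers can be normalized on the
objectives. -/
theorem exists_kkt_multipliers {f : Fin m → EuclideanSpace ℝ (Fin n) → NonemptyInterval ℝ}
    (hf : ∀ k, IntervalFun.LocallyLipschitz (f k))
    {g : Fin p → EuclideanSpace ℝ (Fin n) → ℝ} (hg : ∀ j, LocallyLipschitz (g j))
    {x u : EuclideanSpace ℝ (Fin n)} (hx : ∀ j, g j x ≤ 0) (hbcq : BCQ g x) {c : ℝ} (hc : 0 ≤ c)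
    (hmin : ∀ᶠ y in 𝓝 x, (∀ j, g j y ≤ 0) → ∃ k,
      RealInterval.center (f k x) + c * ‖x - u‖ ≤ RealInterval.center (f k y) + c * ‖y - u‖ ∨
      RealInterval.width (f k x) + c * ‖x - u‖ ≤ RealInterval.width (f k y) + c * ‖y - u‖) :
    ∃ (lam : Fin m → ℝ) (μ : Fin p → ℝ), 0 ≤ lam ∧ 0 ≤ μ ∧ ∑ k, lam k = 1 ∧
      (0 : EuclideanSpace ℝ (Fin n)) ∈ ∑ k, lam k • IntervalFun.weakGradient (f k) x
        + ∑ j ∈ activeSet g x, μ j • clarkeGradient (g j) x + Metric.closedBall 0 c ∧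
      ∀ j, μ j * g j x = 0 := by
  obtain ⟨α, β, v, b, ξ, hα, hβ, hαβ, hβ0, hv, hb, hξ, hsum⟩ :=
    exists_fritzJohn_multipliers hf hg hx hc hmin
  set s := ∑ k, α k with hs
  have hs0 : 0 < s := by
    -- If every `α k` vanished, `β` would have sum `1` and violate the constraint qualification.
    refine (Finset.sum_nonneg fun k _ => hα k).lt_of_ne fun h => hbcq ⟨β, hβ, ?_, hβ0, ?_⟩
    · rintro rfl
      simp [hs, ← h] at hαβ
    · have hα0 : ∀ k, α k = 0 := fun k =>
        (Finset.sum_eq_zero_iff_of_nonneg fun k _ => hα k).1 h.symm k (Finset.mem_univ k)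
      have : ∑ j, β j • ξ j = 0 := by simpa [hα0] using hsum
      rw [← this]
      exact Set.finsetSum_mem_finsetSum _ _ _ fun j _ => Set.smul_mem_smul_set (hξ j)
  have hcompl : ∀ j, β j * g j x = 0 := fun j => by
    by_cases hj : j ∈ activeSet g x
    · have : g j x = 0 := by simpa [activeSet] using hj
      rw [this, mul_zero]
    · rw [hβ0 j hj, zero_mul]
  refine ⟨fun k => s⁻¹ * α k, fun j => s⁻¹ * β j,
    fun k => mul_nonneg (inv_nonneg.2 hs0.le) (hα k),
    fun j => mul_nonneg (inv_nonneg.2 hs0.le) (hβ j), ?_, ?_, fun j => ?_⟩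
  · rw [← Finset.mul_sum, inv_mul_cancel₀ hs0.ne']
  · have hzero : ∑ k, (s⁻¹ * α k) • v k + ∑ j ∈ activeSet g x, (s⁻¹ * β j) • ξ j
        + ∑ k, (s⁻¹ * α k) • b k = 0 := by
      have h1 : ∑ j ∈ activeSet g x, (s⁻¹ * β j) • ξ j = ∑ j, (s⁻¹ * β j) • ξ j :=
        Finset.sum_subset (Finset.subset_univ _) fun j _ hj => by simp [hβ0 j hj]
      have h2 := congrArg (fun z => s⁻¹ • z) hsum
      simp only [smul_add, Finset.smul_sum, smul_smul, Finset.sum_add_distrib, smul_zero] at h2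
      rw [h1, ← h2]
      abel
    refine Set.mem_add.2 ⟨_, Set.add_mem_add ?_ ?_, _, ?_, hzero⟩
    · exact Set.finsetSum_mem_finsetSum _ _ _ fun k _ => Set.smul_mem_smul_set (hv k)
    · exact Set.finsetSum_mem_finsetSum _ _ _ fun j _ => Set.smul_mem_smul_set (hξ j)
    · rw [mem_closedBall_zero_iff]
      -- The normalized weights sum to `1`, so the separate ball terms average to one vector of the
      -- same ball.
      calc ‖∑ k, (s⁻¹ * α k) • b k‖ ≤ ∑ k, (s⁻¹ * α k) * c := by
            refine norm_sum_le_of_le _ fun k _ => ?_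
            have h := mul_nonneg (inv_nonneg.2 hs0.le) (hα k)
            rw [norm_smul, Real.norm_of_nonneg h]
            exact mul_le_mul_of_nonneg_left (hb k) h
        _ = c := by rw [← Finset.sum_mul, ← Finset.mul_sum, inv_mul_cancel₀ hs0.ne', one_mul]
  · rw [mul_assoc, hcompl, mul_zero]

end Multipliers

/-! ### Penalized minimization -/

section Penalization

/-- A nonnegative continuous function with value at most `e` at `u` attains a local minimum,
after adding `(e / δ) * ‖· - u‖`, at a point of the `δ`-ball around `u`. -/
theorem exists_isLocalMinOn_add_mul_norm {E : Type*} [NormedAddCommGroup E] [ProperSpace E]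
    {S : Set E} (hS : IsClosed S) {φ : E → ℝ} (hφ : Continuous φ) (hφ0 : ∀ y ∈ S, 0 ≤ φ y)
    {u : E} (hu : u ∈ S) {e δ : ℝ} (he : 0 < e) (hδ : 0 < δ) (hφu : φ u ≤ e) :
    ∃ x ∈ S, ‖x - u‖ ≤ δ ∧ ∀ᶠ y in 𝓝 x, y ∈ S → φ x + e / δ * ‖x - u‖ ≤ φ y + e / δ * ‖y - u‖ := by
  -- Radius `2 * δ` leaves room: the minimizer lies within `δ`, hence inside the ball, so its
  -- minimality is local on all of `S`.
  obtain ⟨x, ⟨hxS, -⟩, hx⟩ := ((isCompact_closedBall u (2 * δ)).inter_left hS).exists_isMinOn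
    ⟨u, hu, Metric.mem_closedBall_self (by linarith)⟩
    (f := fun y => φ y + e / δ * ‖y - u‖) (by fun_prop)
  have hxu : ‖x - u‖ ≤ δ := by
    have h1 : φ x + e / δ * ‖x - u‖ ≤ φ u + e / δ * ‖u - u‖ :=
      hx ⟨hu, Metric.mem_closedBall_self (by linarith)⟩
    rw [sub_self, norm_zero, mul_zero, add_zero] at h1
    have h2 : e / δ * ‖x - u‖ ≤ e / δ * δ := by
      rw [div_mul_cancel₀ e hδ.ne']
      linarith [hφ0 x hxS]
    exact le_of_mul_le_mul_left h2 (div_pos he hδ)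
  refine ⟨x, hxS, hxu, ?_⟩
  have hnhds : Metric.closedBall u (2 * δ) ∈ 𝓝 x := by
    refine Metric.closedBall_mem_nhds_of_mem ?_
    rw [Metric.mem_ball, dist_eq_norm]
    linarith
  filter_upwards [hnhds] with y hy hyS using hx ⟨hyS, hy⟩

end Penalization

/-! ### Necessary conditions at an equilibrium -/

theorem theorem5p1 {l n m p : ℕ} (G : IntervalGame l n m p)
    (ε : Fin m → ℝ≥0) (hε : ε ≠ 0)
    (u : Fin l → EuclideanSpace ℝ (Fin n)) (hu : G.IsWeakNash ε u)
    (hF : ∀ i k, IntervalFun.LocallyLipschitz (G.ownLoss i k u))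
    (hg : ∀ i j, LocallyLipschitz (G.constr i j))
    (δ : ℝ) (hδ : 0 < δ)
    (hBCQ : ∀ i, ∀ x ∈ G.strategyBall i (u i) δ, BCQ (G.constr i) x) :
    ∀ i, ∃ x ∈ G.strategyBall i (u i) δ, ∃ (lam : Fin m → ℝ) (μ : Fin p → ℝ),
      0 ≤ lam ∧ 0 ≤ μ ∧ ∑ k, lam k = 1 ∧
      (0 : EuclideanSpace ℝ (Fin n)) ∈
        ∑ k, lam k • IntervalFun.weakGradient (G.ownLoss i k u) x
          + ∑ j ∈ activeSet (G.constr i) x, μ j • clarkeGradient (G.constr i j) x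
          + ((1 / δ) * ((Finset.univ.sup ε : ℝ≥0) : ℝ)) •
              Metric.closedBall (0 : EuclideanSpace ℝ (Fin n)) 1 ∧
      ∀ j, μ j * G.constr i j x = 0 := by
  intro i
  obtain ⟨k₀, hk₀⟩ := Function.ne_iff.1 hε
  have hne : (Finset.univ : Finset (Fin m)).Nonempty := ⟨k₀, Finset.mem_univ k₀⟩
  set e : ℝ := ((Finset.univ.sup ε : ℝ≥0) : ℝ) with he
  have hεe : ∀ k, (ε k : ℝ) ≤ e := fun k =>
    NNReal.coe_le_coe.2 (Finset.le_sup (Finset.mem_univ k))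
  have he0 : 0 < e := lt_of_lt_of_le (NNReal.coe_pos.2 (pos_iff_ne_zero.2 hk₀)) (hεe k₀)
  set φ : EuclideanSpace ℝ (Fin n) → ℝ := fun y => Finset.univ.sup' hne fun k =>
    max (RealInterval.center (G.ownLoss i k u y) - RealInterval.center (G.loss i k u) + ε k / 2)
      (RealInterval.width (G.ownLoss i k u y) - RealInterval.width (G.loss i k u) + ε k / 2)
    with hφ
  have hown : ∀ k, G.ownLoss i k u (u i) = G.loss i k u := fun k => by
    rw [IntervalGame.ownLoss, Function.update_eq_self]
  have hcont : Continuous φ := by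
    refine Continuous.finset_sup'_apply hne fun k _ => ?_
    have h1 := (hF i k).center.continuous
    have h2 := (hF i k).width.continuous
    fun_prop
  have hclosed : IsClosed (G.strategySet i) := by
    rw [IntervalGame.strategySet, Set.ofPred_forall]
    exact isClosed_iInter fun j => isClosed_le (hg i j).continuous continuous_const
  have hnonneg : ∀ y ∈ G.strategySet i, 0 ≤ φ y := by
    intro y hy
    -- A negative value of `φ` would make `y` a profitable deviation.
    by_contra! hneg
    refine hu.2 i ⟨y, hy, fun k => ?_⟩
    have h := max_lt_iff.1 ((Finset.sup'_lt_iff hne).1 hneg k (Finset.mem_univ k))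
    simp only [RealInterval.CWLT, RealInterval.center, RealInterval.width, RealInterval.zeroTo,
      NonemptyInterval.fst_add, NonemptyInterval.snd_add] at h ⊢
    constructor <;> linarith [h.1, h.2]
  have hφu : φ (u i) ≤ e / 2 := by
    refine Finset.sup'_le hne _ fun k _ => ?_
    simp only [hown, sub_self, zero_add, max_self]
    linarith [hεe k]
  obtain ⟨x, hxS, hxu, hmin⟩ := exists_isLocalMinOn_add_mul_norm hclosed hcont hnonneg (hu.1 i)
    (half_pos he0) hδ hφu
  obtain ⟨lam, μ, hlam, hμ, hsum, hzero, hcompl⟩ := exists_kkt_multipliers (u := u i)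
    (c := e / 2 / δ) (hF i) (hg i) hxS (hBCQ i x ⟨hxS, hxu⟩) (by positivity) <| by
      filter_upwards [hmin] with y hy hyS
      -- Choose `k` attaining the maximum at `y`; at `x` its terms are at most `φ x`, and the
      -- constants cancel.
      obtain ⟨k, -, hk⟩ := Finset.exists_mem_eq_sup' hne fun k =>
        max (RealInterval.center (G.ownLoss i k u y) - RealInterval.center (G.loss i k u)
            + ε k / 2)
          (RealInterval.width (G.ownLoss i k u y) - RealInterval.width (G.loss i k u) + ε k / 2)
      have hxk := Finset.le_sup' (fun k =>
        max (RealInterval.center (G.ownLoss i k u x) - RealInterval.center (G.loss i k u)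
            + ε k / 2)
          (RealInterval.width (G.ownLoss i k u x) - RealInterval.width (G.loss i k u) + ε k / 2))
        (Finset.mem_univ k)
      have hxy := hy hyS
      have hyk : φ y = _ := hk
      have hxk' := max_le_iff.1 (show _ ≤ φ x from hxk)
      refine ⟨k, ?_⟩
      rcases max_choice (RealInterval.center (G.ownLoss i k u y)
          - RealInterval.center (G.loss i k u) + ε k / 2)
        (RealInterval.width (G.ownLoss i k u y) - RealInterval.width (G.loss i k u) + ε k / 2)
        with h | h
      · left
        linarith [hxk'.1]
      · right
        linarith [hxk'.2]
  refine ⟨x, ⟨hxS, hxu⟩, lam, μ, hlam, hμ, hsum, ?_, hcompl⟩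
  -- The argument gives the radius `e / 2 / δ`, half of the one claimed.
  refine Set.add_subset_add_left ?_ hzero
  rw [smul_unitClosedBall_of_nonneg (by positivity)]
  refine Metric.closedBall_subset_closedBall ?_
  rw [div_mul_eq_mul_div, one_mul]
  gcongr
  linarith
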